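/- Let $\mathcal H=\mathbb C^d$ with $d\ge 1$, and let $\mathscr A=\{A_j\}_j$ be a (discrete) POVM on $\mathcal H$, that is, a family of positive semidefinite operators with $\sum_j A_j=1$. Suppose $\mathscr A$ is simple, meaning that its elements are pairwise linearly independent. For a POVM $\mathscr B=\{B_k\}_k$ on $\mathcal H^{\otimes N}$, let the estimation fidelity be $$F(\mathscr B)=\max_{\{\hat\rho_k\}_k}\ \sum_k\int \operatorname{tr}\bigl(\rho^{\otimes N}B_k\bigr)\,\operatorname{tr}\bigl(\rho\,\hat\rho_k\bigr)\,d\mu(\psi),\qquad \rho=|\psi\rangle\langle\psi|,$$ where $\mu$ is the unitarily invariant (Haar) probability measure on pure states of $\mathcal H$ and the maximum is over all choices of density operators $\hat\rho_k$ on $\mathcal H$. Let $\mathscr A^{\otimes 2}=\{A_j\otimes A_k\}_{j,k}$. Then $\mathscr A$ is a rank-1 projective measurement (all the $A_j$ are mutually orthogonal rank-1 projectors) if and only if $$F(\mathscr A^{\otimes 2})=F(\mathscr A)=\frac{2}{d+1}.$$ -/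

import Mathlib

open MeasureTheory
open scoped Kronecker ComplexOrder

/-- A discrete POVM with (possibly infinite) outcome set `ι` on the Hilbert space `ℂ^κ`: a family of
positive semidefinite operators that sum up to the identity. For a finite outcome set `HasSum` is
the ordinary finite sum. -/
structure POVM (ι : Type*) (κ : Type*) [Fintype κ] [DecidableEq κ] where
  /-- The POVM elements. -/
  elem : ι → Matrix κ κ ℂ
  posSemidef : ∀ j, (elem j).PosSemidef
  hasSum_one : HasSum elem 1

namespace POVM

variable {ι ι' κ κ' : Type*} [Fintype κ] [DecidableEq κ] [Fintype κ'] [DecidableEq κ']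

/-- The POVM elements are pairwise linearly independent. -/
def IsSimple (A : POVM ι κ) : Prop :=
  Pairwise fun j k => LinearIndependent ℂ ![A.elem j, A.elem k]

/-- All POVM elements are mutually orthogonal rank-1 (orthogonal) projectors. -/
def IsRankOneProjective (A : POVM ι κ) : Prop :=
  (∀ j, IsStarProjection (A.elem j) ∧ (A.elem j).rank = 1) ∧
    Pairwise fun j k => A.elem j * A.elem k = 0

theorem hasSum_mul_complex {f : ι → ℂ} {g : ι' → ℂ} {a b : ℂ} (hf : HasSum f a)
    (hg : HasSum g b) : HasSum (fun p : ι × ι' => f p.1 * g p.2) (a * b) :=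
  hf.mul hg (summable_mul_of_summable_norm (f := f) (g := g) hf.summable.norm hg.summable.norm)

theorem hasSum_kronecker {f : ι → Matrix κ κ ℂ} {g : ι' → Matrix κ' κ' ℂ}
    (hf : HasSum f 1) (hg : HasSum g 1) :
    HasSum (fun p : ι × ι' => f p.1 ⊗ₖ g p.2) (1 : Matrix (κ × κ') (κ × κ') ℂ) := by
  rw [← Matrix.one_kronecker_one]
  exact Pi.hasSum.2 fun x => Pi.hasSum.2 fun y => hasSum_mul_complex
    (f := fun j => f j x.1 y.1) (g := fun j => g j x.2 y.2)
    (Pi.hasSum.1 (Pi.hasSum.1 hf x.1) y.1) (Pi.hasSum.1 (Pi.hasSum.1 hg x.2) y.2)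

/-- The product POVM `A ⊗ B`, with elements `A_j ⊗ B_k`. -/
def tensor (A : POVM ι κ) (B : POVM ι' κ') : POVM (ι × ι') (κ × κ') where
  elem p := A.elem p.1 ⊗ₖ B.elem p.2
  posSemidef p := (A.posSemidef p.1).kronecker (B.posSemidef p.2)
  hasSum_one := hasSum_kronecker A.hasSum_one B.hasSum_one

end POVM

/-- Quantum states (density operators) on `ℂ^d`. -/
def DensityMatrix (d : ℕ) : Type :=
  {σ : Matrix (Fin d) (Fin d) ℂ // σ.PosSemidef ∧ σ.trace = 1}

/-- Unit vectors of `ℂ^d`. -/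
abbrev StateVector (d : ℕ) : Type :=
  Metric.sphere (0 : EuclideanSpace ℂ (Fin d)) 1

/-- The pure state `|ψ⟩⟨ψ|`. -/
def pureState {d : ℕ} (ψ : StateVector d) : Matrix (Fin d) (Fin d) ℂ :=
  Matrix.vecMulVec (fun i => ψ.1 i) (fun i => star (ψ.1 i))

/-- The distribution of a Haar random state vector: the normalized surface measure of the unit
sphere of `ℂ^d`, that is, the unitarily invariant probability measure on it. -/
noncomputable def haarState (d : ℕ) : Measure (StateVector d) :=
  ((volume : Measure (EuclideanSpace ℂ (Fin d))).toSphere Set.univ)⁻¹ •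
    (volume : Measure (EuclideanSpace ℂ (Fin d))).toSphere

namespace POVM

variable {ι κ : Type*} [Fintype κ] [DecidableEq κ] {d : ℕ}

/-- The average fidelity achieved with the estimators `est j`, when `ρ` is a Haar random pure state
and the POVM is performed on the state `copies ρ` (such as `ρ` or `ρ ⊗ ρ`): the sum over `j` of the
integrals of `p_j * tr (ρ * est j)`, where `p_j = tr (copies ρ * A_j)`. -/
noncomputable def averageFidelity (copies : Matrix (Fin d) (Fin d) ℂ → Matrix κ κ ℂ)
    (A : POVM ι κ) (est : ι → DensityMatrix d) : ℝ :=
  ∑' j, ∫ ψ, (copies (pureState ψ) * A.elem j).trace.re *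
    (pureState ψ * (est j).1).trace.re ∂(haarState d)

/-- The maximum average fidelity over all choices of the estimators. -/
noncomputable def estimationFidelity (copies : Matrix (Fin d) (Fin d) ℂ → Matrix κ κ ℂ)
    (A : POVM ι κ) : ℝ :=
  ⨆ est : ι → DensityMatrix d, A.averageFidelity copies est

/-- The one-copy estimation fidelity `F(A)` of a POVM on `ℂ^d`. -/
noncomputable def fidelityOneCopy (A : POVM ι (Fin d)) : ℝ :=
  A.estimationFidelity fun ρ => ρ

/-- The two-copy estimation fidelity `F(A)` of a POVM on `ℂ^d ⊗ ℂ^d`. -/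
noncomputable def fidelityTwoCopy (A : POVM ι (Fin d × Fin d)) : ℝ :=
  A.estimationFidelity fun ρ => ρ ⊗ₖ ρ

end POVM

/-! ### Gaussian moments -/

/-! Both fidelities reduce to trace formulas through the third Haar moment
(`integral_expectation_mul_mul`): the average of `⟨A⟩⟨B⟩⟨C⟩` is `symmetricTrace A B C / (d (d+1)
(d+2))`. By polarization only cubes `⟨A⟩ ^ 3` are needed; these come from a Gaussian integral that
factorizes in an eigenbasis of `A`, with the constants fixed by the case `A = 1`.

For one copy, outcome `j` contributes `(tr A_j + tr (A_j σ)) / (d (d+1))`. Since `σ ≤ 1`, the total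
is at most `2 / (d+1)`, and equality forces the top eigenvalue of each `A_j` to be its trace, so
`A_j` has rank at most one.

For two copies of such a POVM, ignoring the second outcome and guessing `A_j / tr A_j` gives `2 tr
A_j tr A_k + 4 tr (A_j A_k)` on each pair, which again adds up to `2 / (d+1)`. Hence the two-copy
fidelity is `2 / (d+1)` exactly when this guess is optimal for every pair (`le_of_iSup_tsum_eq`).
Optimality makes `A_j` an eigenprojection, up to scale, of a Hermitian matrix built from `A_j` and
`A_k`; together with linear independence this forces `A_j A_k = 0`
(`mul_eq_zero_of_symmetricTrace_le`). Orthogonality and `∑ A_j = 1` then give projectors. For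
orthogonal rank-1 projectors the guess is optimal because `A_j + A_k ≤ 1`. -/

theorem integral_norm_pow_mul_exp_neg_sq (n : ℕ) :
    ∫ z : ℂ, ‖z‖ ^ (2 * n) * Real.exp (-‖z‖ ^ 2) = Real.pi * n.factorial := by
  have h := Complex.integral_rpow_mul_exp_neg_rpow (p := 2) (q := ((2 * n : ℕ) : ℝ))
    (by norm_num) (by have : (0 : ℝ) ≤ ((2 * n : ℕ) : ℝ) := Nat.cast_nonneg _
                      linarith)
  have e : (((2 * n : ℕ) : ℝ) + 2) / 2 = (n : ℝ) + 1 := by push_cast; ring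
  rw [e, Real.Gamma_nat_eq_factorial] at h
  simp only [Real.rpow_natCast, Real.rpow_two] at h
  rw [h]; ring

theorem integral_prod_norm_pow_mul_exp {ι : Type*} [Fintype ι] (n : ι → ℕ) :
    ∫ x : ι → ℂ, ∏ l, (‖x l‖ ^ (2 * n l) * Real.exp (-‖x l‖ ^ 2)) =
      Real.pi ^ Fintype.card ι * ∏ l, ((n l).factorial : ℝ) := by
  rw [volume_pi, integral_fintype_prod_eq_prod
    (f := fun l (z : ℂ) => ‖z‖ ^ (2 * n l) * Real.exp (-‖z‖ ^ 2))]
  simp [integral_norm_pow_mul_exp_neg_sq, Finset.prod_mul_distrib]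

/-- Both sides count the permutations of three slots that fix the tuple `(i, j, k)`: the identity,
three transpositions and two 3-cycles. -/
theorem prod_factorial_three {ι : Type*} [Fintype ι] [DecidableEq ι] (i j k : ι) :
    ∏ l, ((((if i = l then 1 else 0) + (if j = l then 1 else 0) +
      (if k = l then 1 else 0) : ℕ).factorial : ℕ) : ℝ) =
      1 + (if i = j then 1 else 0) + (if j = k then 1 else 0) + (if i = k then 1 else 0) +
        2 * (if i = j then (if j = k then 1 else 0) else 0) := by
  have key : ∀ (m : ι) (c : ℝ), (∏ l, if m = l then c else 1) = c := fun m c => by simp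
  by_cases hij : i = j
  · subst hij
    by_cases hik : i = k
    · subst hik
      refine (Finset.prod_congr rfl fun l _ => ?_).trans ((key i 6).trans ?_)
      · by_cases h : i = l <;> simp [h, Nat.factorial]
      · norm_num
    · refine (Finset.prod_congr rfl fun l _ => ?_).trans ((key i 2).trans ?_)
      · by_cases h : i = l
        · subst h; simp [Ne.symm hik]
        · by_cases h' : k = l <;> simp [h, h']
      · simp [hik]; norm_num
  · by_cases hjk : j = k
    · subst hjk
      refine (Finset.prod_congr rfl fun l _ => ?_).trans ((key j 2).trans ?_)
      · by_cases h : j = l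
        · subst h; simp [hij]
        · by_cases h' : i = l <;> simp [h, h']
      · simp [hij]; norm_num
    · by_cases hik : i = k
      · subst hik
        refine (Finset.prod_congr rfl fun l _ => ?_).trans ((key i 2).trans ?_)
        · by_cases h : i = l
          · subst h; simp [hjk]
          · by_cases h' : j = l <;> simp [h, h']
        · simp [hij, hjk]; norm_num
      · refine (Finset.prod_congr rfl fun l _ => ?_).trans ((key i 1).trans ?_)
        · by_cases h : i = l
          · subst h; simp [Ne.symm hij, Ne.symm hik]
          · by_cases h' : j = l
            · subst h'; simp [hij, Ne.symm hjk]
            · by_cases h'' : k = l <;> simp [h, h', h'']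
        · simp [hij, hjk, hik]

/-- Each permutation contributes one power sum per cycle, whence the cycle index of the symmetric
group on three letters. -/
theorem sum_three_pairings {ι : Type*} [Fintype ι] [DecidableEq ι] (w : ι → ℝ) :
    ∑ i, ∑ j, ∑ k, w i * w j * w k *
      (1 + (if i = j then 1 else 0) + (if j = k then 1 else 0) + (if i = k then 1 else 0) +
        2 * (if i = j then (if j = k then 1 else 0) else 0)) =
      (∑ i, w i) ^ 3 + 3 * (∑ i, w i) * (∑ i, w i ^ 2) + 2 * ∑ i, w i ^ 3 := by
  set s := ∑ i, w i with hs
  have h1 : ∀ i j, ∑ k, w i * w j * w k *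
      (1 + (if i = j then 1 else 0) + (if j = k then 1 else 0) + (if i = k then 1 else 0) +
        2 * (if i = j then (if j = k then 1 else 0) else 0)) =
      (w i * s * w j + w i * w j ^ 2 + w i ^ 2 * w j) +
        (if i = j then w i * w j * s + 2 * (w i * w j ^ 2) else 0) := fun i j => by
    by_cases h : i = j
    · simp only [h, if_true, mul_add, mul_one, Finset.sum_add_distrib, ← Finset.mul_sum, mul_ite,
        mul_zero, Finset.sum_ite_eq, Finset.mem_univ, ← hs]
      ring
    · simp only [h, if_false, mul_add, mul_one, Finset.sum_add_distrib, ← Finset.mul_sum, mul_ite,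
        mul_zero, Finset.sum_ite_eq, Finset.mem_univ, if_true, ← hs, Finset.sum_const_zero]
      ring
  have h2 : ∀ i, ∑ j, ((w i * s * w j + w i * w j ^ 2 + w i ^ 2 * w j) +
      (if i = j then w i * w j * s + 2 * (w i * w j ^ 2) else 0)) =
      (s ^ 2 + ∑ j, w j ^ 2) * w i + 2 * s * w i ^ 2 + 2 * w i ^ 3 := fun i => by
    simp only [Finset.sum_add_distrib, Finset.sum_ite_eq, Finset.mem_univ, if_true,
      ← Finset.mul_sum, ← hs]
    ring
  simp only [h1, h2, Finset.sum_add_distrib, ← Finset.mul_sum, ← hs]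
  ring

theorem integral_sum_cube_mul_exp {ι : Type*} [Fintype ι] (w : ι → ℝ) :
    ∫ x : ι → ℂ, (∑ i, w i * ‖x i‖ ^ 2) ^ 3 * Real.exp (-∑ i, ‖x i‖ ^ 2) =
      Real.pi ^ Fintype.card ι *
        ((∑ i, w i) ^ 3 + 3 * (∑ i, w i) * (∑ i, w i ^ 2) + 2 * ∑ i, w i ^ 3) := by
  classical
  let n : ι → ι → ι → ι → ℕ := fun i j k l =>
    (if i = l then 1 else 0) + (if j = l then 1 else 0) + (if k = l then 1 else 0)
  let g : ι → ι → ι → (ι → ℂ) → ℝ := fun i j k x =>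
    ∏ l, (‖x l‖ ^ (2 * n i j k l) * Real.exp (-‖x l‖ ^ 2))
  have hg : ∀ i j k, ∫ x, g i j k x = Real.pi ^ Fintype.card ι *
      (1 + (if i = j then 1 else 0) + (if j = k then 1 else 0) + (if i = k then 1 else 0) +
        2 * (if i = j then (if j = k then 1 else 0) else 0)) := fun i j k => by
    rw [integral_prod_norm_pow_mul_exp, prod_factorial_three]
  have hgi : ∀ i j k, Integrable (g i j k) := fun i j k => by
    -- A non-integrable function has Bochner integral zero, so the nonzero value already computed
    -- gives integrability.
    refine Integrable.of_integral_ne_zero ?_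
    simp only [g]
    rw [integral_prod_norm_pow_mul_exp]
    exact mul_ne_zero (pow_ne_zero _ Real.pi_ne_zero)
      (Finset.prod_ne_zero_iff.2 fun l _ => Nat.cast_ne_zero.2 (Nat.factorial_ne_zero _))
  have hpt : ∀ x : ι → ℂ, (∑ i, w i * ‖x i‖ ^ 2) ^ 3 * Real.exp (-∑ i, ‖x i‖ ^ 2) =
      ∑ i, ∑ j, ∑ k, w i * w j * w k * g i j k x := fun x => by
    have e : ∀ i j k, g i j k x =
        ‖x i‖ ^ 2 * ‖x j‖ ^ 2 * ‖x k‖ ^ 2 * Real.exp (-∑ i, ‖x i‖ ^ 2) := fun i j k => by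
      have e1 : ∀ m : ι, ∏ l, ‖x l‖ ^ (2 * if m = l then 1 else 0) = ‖x m‖ ^ 2 := fun m => by
        rw [Finset.prod_eq_single m] <;> simp +contextual [eq_comm]
      simp only [g, n, mul_add, pow_add, Finset.prod_mul_distrib, e1]
      rw [← Finset.sum_neg_distrib, Real.exp_sum]
    simp only [e, pow_succ (∑ i, w i * ‖x i‖ ^ 2), pow_zero, one_mul, Finset.sum_mul,
      Finset.mul_sum]
    rw [Finset.sum_comm]
    refine Finset.sum_congr rfl fun i _ => ?_
    rw [Finset.sum_comm]
    refine Finset.sum_congr rfl fun j _ => Finset.sum_congr rfl fun k _ => by ring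
  simp only [hpt]
  have hI : ∀ i j k, Integrable (fun x => w i * w j * w k * g i j k x) :=
    fun i j k => (hgi i j k).const_mul _
  rw [integral_finsetSum _ fun i _ => integrable_finsetSum _ fun j _ =>
    integrable_finsetSum _ fun k _ => hI i j k]
  simp_rw [integral_finsetSum _ fun j _ => integrable_finsetSum _ fun k _ => hI _ j k]
  simp_rw [integral_finsetSum _ fun k _ => hI _ _ k]
  simp_rw [integral_const_mul, hg]
  simp_rw [mul_left_comm _ (Real.pi ^ Fintype.card ι), ← Finset.mul_sum]
  rw [sum_three_pairings]

/-! ### Polar coordinates -/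

/-- `K` is the radial integral in polar coordinates. Only its independence of `f` matters, since it
cancels on normalization. -/
theorem integral_homogeneous_mul_exp {E : Type*} [NormedAddCommGroup E] [NormedSpace ℝ E]
    [MeasurableSpace E] [BorelSpace E] [FiniteDimensional ℝ E] [Nontrivial E] (μ : Measure E)
    [μ.IsAddHaarMeasure] (m : ℕ) :
    ∃ K : ℝ, ∀ f : E → ℝ, (∀ (r : ℝ) (x : E), f (r • x) = r ^ m * f x) →
      ∫ x, f x * Real.exp (-‖x‖ ^ 2) ∂μ = (∫ x, f x.1 ∂μ.toSphere) * K := by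
  refine ⟨∫ r, r.1 ^ m * Real.exp (-r.1 ^ 2) ∂(Measure.volumeIoiPow (Module.finrank ℝ E - 1)),
    fun f hf => ?_⟩
  rw [← integral_prod_mul (f := fun x : Metric.sphere (0 : E) 1 => f x.1)
    (g := fun r : Set.Ioi (0 : ℝ) => r.1 ^ m * Real.exp (-r.1 ^ 2)),
    ← μ.measurePreserving_homeomorphUnitSphereProd.integral_comp
      (Homeomorph.measurableEmbedding _)]
  have : ∫ x, f x * Real.exp (-‖x‖ ^ 2) ∂μ =
      ∫ x in ({0}ᶜ : Set E), f x * Real.exp (-‖x‖ ^ 2) ∂μ := by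
    rw [restrict_compl_singleton]
  rw [this, ← integral_subtype_comap (measurableSet_singleton _).compl]
  refine integral_congr_ae (Filter.Eventually.of_forall fun x => ?_)
  have hx : ‖x.1‖ ≠ 0 := norm_ne_zero_iff.2 x.2
  have h : x.1 = ‖x.1‖ • (‖x.1‖⁻¹ • x.1) := by rw [smul_smul, mul_inv_cancel₀ hx, one_smul]
  have h2 := hf ‖x.1‖ (‖x.1‖⁻¹ • x.1)
  rw [← h] at h2
  simp only [homeomorphUnitSphereProd_apply_fst_coe, homeomorphUnitSphereProd_apply_snd_coe]
  rw [h2]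
  ring

/-- Uniqueness of Haar measure; the value of `c` is immaterial because it also cancels. -/
theorem exists_volume_euclideanSpace_eq (d : ℕ) :
    ∃ c : ℝ, 0 < c ∧ ∀ f : EuclideanSpace ℂ (Fin d) → ℝ,
      ∫ x, f x = c * ∫ x : Fin d → ℂ, f (WithLp.toLp 2 x) := by
  let e : (Fin d → ℂ) ≃L[ℝ] EuclideanSpace ℂ (Fin d) :=
    (PiLp.continuousLinearEquiv 2 ℝ (fun _ : Fin d => ℂ)).symm
  have : (Measure.map e (volume : Measure (Fin d → ℂ))).IsAddHaarMeasure :=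
    e.isAddHaarMeasure_map volume
  have h := Measure.isAddLeftInvariant_eq_smul (volume : Measure (EuclideanSpace ℂ (Fin d)))
    (Measure.map e (volume : Measure (Fin d → ℂ)))
  refine ⟨(Measure.addHaarScalarFactor (volume : Measure (EuclideanSpace ℂ (Fin d)))
    (Measure.map e (volume : Measure (Fin d → ℂ))) : ℝ),
    NNReal.coe_pos.2 (Measure.addHaarScalarFactor_pos_of_isAddHaarMeasure _ _), fun f => ?_⟩
  conv_lhs => rw [h]
  rw [integral_smul_nnreal_measure,
    MeasurableEmbedding.integral_map (f := e) e.toHomeomorph.measurableEmbedding]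
  rfl

/-! ### Expectation values -/

/-- The expectation value `⟨x|A|x⟩` (its real part). -/
noncomputable def expectation {d : ℕ} (A : Matrix (Fin d) (Fin d) ℂ)
    (x : EuclideanSpace ℂ (Fin d)) : ℝ :=
  (Matrix.vecMulVec (fun i => x i) (fun i => star (x i)) * A).trace.re

theorem expectation_eq_sum_eigenvalues {d : ℕ} {A : Matrix (Fin d) (Fin d) ℂ}
    (hA : A.IsHermitian) (x : EuclideanSpace ℂ (Fin d)) :
    expectation A x = ∑ i, hA.eigenvalues i * ‖hA.eigenvectorBasis.repr x i‖ ^ 2 := by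
  have hrep : ∀ i, hA.eigenvectorBasis.repr x i =
      ∑ k, star (hA.eigenvectorUnitary.1 k i) * x k := fun i => by
    rw [OrthonormalBasis.repr_apply_apply, PiLp.inner_apply]
    refine Finset.sum_congr rfl fun k _ => ?_
    rw [Matrix.IsHermitian.eigenvectorUnitary_apply]
    simp [mul_comm]
  have hsp := hA.spectral_theorem
  rw [Unitary.conjStarAlgAut_apply] at hsp
  generalize hA.eigenvectorUnitary.1 = U at hrep hsp
  unfold expectation
  conv_lhs => rw [hsp]
  rw [← Matrix.mul_assoc, Matrix.trace_mul_comm, ← Matrix.mul_assoc, ← Matrix.mul_assoc,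
    Matrix.mul_vecMulVec, Matrix.vecMulVec_mul, Matrix.trace, Complex.re_sum]
  refine Finset.sum_congr rfl fun i _ => ?_
  have h1 : ((star U).mulVec fun i => x i) i = hA.eigenvectorBasis.repr x i := by
    rw [hrep]; rfl
  have h2 : (Matrix.vecMul (fun i => star (x i)) U) i = star (hA.eigenvectorBasis.repr x i) := by
    rw [hrep, star_sum]
    simp only [Matrix.vecMul, dotProduct, star_mul', star_star]
    exact Finset.sum_congr rfl fun k _ => mul_comm _ _
  rw [Matrix.diag_apply, Matrix.mul_diagonal, Matrix.vecMulVec_apply, h1, h2]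
  simp only [Complex.star_def, Complex.mul_conj, Function.comp_apply]
  rw [← Complex.sq_norm]
  rw [mul_comm]
  exact (Complex.re_ofReal_mul _ _).trans (by rw [Complex.ofReal_re]; rfl)

theorem trace_pow_eq_sum_eigenvalues {d : ℕ} {A : Matrix (Fin d) (Fin d) ℂ}
    (hA : A.IsHermitian) (n : ℕ) : (A ^ n).trace = ((∑ i, hA.eigenvalues i ^ n : ℝ) : ℂ) := by
  conv_lhs => rw [hA.spectral_theorem, ← map_pow, Unitary.conjStarAlgAut_apply,
    Matrix.diagonal_pow, Matrix.trace_mul_comm, ← mul_assoc, Unitary.coe_star_mul_self, one_mul]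
  simp [Matrix.trace]

/-- Passing to an eigenbasis of `A` is an isometry, so it preserves the measure and the Gaussian
weight and leaves a diagonal form. -/
theorem exists_gaussian_integral_expectation_cube (d : ℕ) :
    ∃ c : ℝ, 0 < c ∧ ∀ A : Matrix (Fin d) (Fin d) ℂ, A.IsHermitian →
      ((∫ x, expectation A x ^ 3 * Real.exp (-‖x‖ ^ 2) : ℝ) : ℂ) =
        c * (A.trace ^ 3 + 3 * A.trace * (A ^ 2).trace + 2 * (A ^ 3).trace) := by
  obtain ⟨c, hc0, hc⟩ := exists_volume_euclideanSpace_eq d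
  refine ⟨c * Real.pi ^ d, by positivity, fun A hA => ?_⟩
  let b := hA.eigenvectorBasis
  let e : EuclideanSpace ℂ (Fin d) ≃ₗᵢ[ℝ] EuclideanSpace ℂ (Fin d) :=
    { b.repr.toLinearEquiv.restrictScalars ℝ with norm_map' := b.repr.norm_map }
  have h1 : ∫ x, expectation A x ^ 3 * Real.exp (-‖x‖ ^ 2) =
      ∫ x : EuclideanSpace ℂ (Fin d),
        (∑ i, hA.eigenvalues i * ‖x i‖ ^ 2) ^ 3 * Real.exp (-∑ i, ‖x i‖ ^ 2) := by
    rw [← e.measurePreserving.integral_comp e.toHomeomorph.measurableEmbedding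
      (fun x => (∑ i, hA.eigenvalues i * ‖x i‖ ^ 2) ^ 3 * Real.exp (-∑ i, ‖x i‖ ^ 2))]
    refine integral_congr_ae (Filter.Eventually.of_forall fun x => ?_)
    have hn : ‖x‖ ^ 2 = ∑ i, ‖b.repr x i‖ ^ 2 := by
      rw [← EuclideanSpace.norm_sq_eq, b.repr.norm_map]
    simp only
    rw [expectation_eq_sum_eigenvalues hA, hn]
    rfl
  have ht := trace_pow_eq_sum_eigenvalues hA
  have ht1 := ht 1
  rw [pow_one] at ht1
  rw [h1, hc, ht1, ht, ht]
  simp only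
  rw [integral_sum_cube_mul_exp]
  push_cast
  simp only [Fintype.card_fin, pow_one]
  ring

/-! ### Haar moments of expectation values -/

theorem continuous_expectation {d : ℕ} (A : Matrix (Fin d) (Fin d) ℂ) :
    Continuous (expectation A) := by
  unfold expectation
  refine Complex.continuous_re.comp ?_
  simp only [Matrix.trace, Matrix.diag, Matrix.mul_apply, Matrix.vecMulVec_apply]
  fun_prop

theorem expectation_smul {d : ℕ} (A : Matrix (Fin d) (Fin d) ℂ) (r : ℝ)
    (x : EuclideanSpace ℂ (Fin d)) : expectation A (r • x) = r ^ 2 * expectation A x := by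
  have : Matrix.vecMulVec (fun i => (r • x) i) (fun i => star ((r • x) i)) =
      ((r ^ 2 : ℝ) : ℂ) • Matrix.vecMulVec (fun i => x i) (fun i => star (x i)) := by
    ext i j
    simp [Matrix.vecMulVec_apply]
    ring
  rw [expectation, this, Matrix.smul_mul, Matrix.trace_smul, smul_eq_mul, Complex.re_ofReal_mul,
    expectation]

theorem expectation_add {d : ℕ} (A B : Matrix (Fin d) (Fin d) ℂ)
    (x : EuclideanSpace ℂ (Fin d)) :
    expectation (A + B) x = expectation A x + expectation B x := by
  simp [expectation, Matrix.mul_add]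

theorem expectation_one {d : ℕ} (ψ : StateVector d) : expectation 1 ψ.1 = 1 := by
  have h : ‖ψ.1‖ = 1 := by simp
  have h2 := EuclideanSpace.norm_sq_eq ψ.1
  rw [h] at h2
  rw [expectation, mul_one, Matrix.trace_vecMulVec, dotProduct, Complex.re_sum]
  simp only [Complex.star_def, Complex.mul_conj, Complex.ofReal_re, Complex.normSq_eq_norm_sq]
  rw [← h2]; norm_num

theorem toSphere_volume_univ_ne_zero {d : ℕ} (hd : 1 ≤ d) :
    (volume : Measure (EuclideanSpace ℂ (Fin d))).toSphere Set.univ ≠ 0 := by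
  have : NeZero d := ⟨by omega⟩
  rw [Measure.toSphere_apply_univ]
  exact mul_ne_zero (Nat.cast_ne_zero.2 Module.finrank_pos.ne')
    (Metric.measure_ball_pos _ _ one_pos).ne'

theorem isFiniteMeasure_haarState {d : ℕ} (hd : 1 ≤ d) : IsFiniteMeasure (haarState d) :=
  Measure.smul_finite _ (ENNReal.inv_ne_top.2 (toSphere_volume_univ_ne_zero hd))

theorem integral_expectation_cube {d : ℕ} (hd : 1 ≤ d) {A : Matrix (Fin d) (Fin d) ℂ}
    (hA : A.IsHermitian) :
    ((∫ ψ, expectation A ψ.1 ^ 3 ∂haarState d : ℝ) : ℂ) * (d * (d + 1) * (d + 2)) =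
      A.trace ^ 3 + 3 * A.trace * (A ^ 2).trace + 2 * (A ^ 3).trace := by
  have : NeZero d := ⟨by omega⟩
  obtain ⟨c, hc0, hc⟩ := exists_gaussian_integral_expectation_cube d
  -- The degree is 6: the cube of a quadratic form.
  obtain ⟨K, hK⟩ := integral_homogeneous_mul_exp
    (volume : Measure (EuclideanSpace ℂ (Fin d))) 6
  have hI : ∀ B : Matrix (Fin d) (Fin d) ℂ, ∫ x, expectation B x ^ 3 * Real.exp (-‖x‖ ^ 2) =
      (∫ x, expectation B x.1 ^ 3
        ∂(volume : Measure (EuclideanSpace ℂ (Fin d))).toSphere) * K := fun B =>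
    hK (fun x => expectation B x ^ 3) fun r x => by rw [expectation_smul]; ring
  set s := (volume : Measure (EuclideanSpace ℂ (Fin d))).toSphere with hs
  -- The case `A = 1` relates `c`, `K` and the area of the sphere, and produces `d ^ 3 + 3 d ^ 2 + 2
  -- d = d (d+1) (d+2)`.
  have h1 := hc 1 Matrix.isHermitian_one
  have h2 := hc A hA
  rw [hI] at h1 h2
  simp only [expectation_one, one_pow, integral_const, smul_eq_mul, mul_one, Matrix.trace_one,
    Fintype.card_fin] at h1
  have hs0 : s.real Set.univ ≠ 0 := by
    have h := toSphere_volume_univ_ne_zero hd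
    exact (measureReal_ne_zero_iff (measure_ne_top _ _)).2 h
  have hh : ∫ ψ, expectation A ψ.1 ^ 3 ∂haarState d =
      (s.real Set.univ)⁻¹ * ∫ x, expectation A x.1 ^ 3 ∂s := by
    rw [haarState, integral_smul_measure, ENNReal.toReal_inv, smul_eq_mul]; rfl
  rw [hh]
  have hc' : (c : ℂ) ≠ 0 := Complex.ofReal_ne_zero.2 hc0.ne'
  have hs' : (s.real Set.univ : ℂ) ≠ 0 := Complex.ofReal_ne_zero.2 hs0
  apply mul_left_cancel₀ hc'
  rw [← h2]
  push_cast at h1 ⊢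
  rw [inv_mul_eq_div, div_mul_eq_mul_div, mul_div_assoc', div_eq_iff hs']
  linear_combination (-(∫ x, expectation A x.1 ^ 3 ∂s : ℝ) : ℂ) * h1

/-- Six times the trace of `A ⊗ B ⊗ C` over the symmetric subspace. -/
noncomputable def symmetricTrace {d : ℕ} (A B C : Matrix (Fin d) (Fin d) ℂ) : ℂ :=
  A.trace * B.trace * C.trace + (A * B).trace * C.trace + (A * C).trace * B.trace +
    (B * C).trace * A.trace + (A * B * C).trace + (B * A * C).trace

theorem integral_expectation_mul_mul {d : ℕ} (hd : 1 ≤ d) {A B C : Matrix (Fin d) (Fin d) ℂ}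
    (hA : A.IsHermitian) (hB : B.IsHermitian) (hC : C.IsHermitian) :
    ((∫ ψ, expectation A ψ.1 * expectation B ψ.1 * expectation C ψ.1 ∂haarState d : ℝ) : ℂ) *
      (d * (d + 1) * (d + 2)) = symmetricTrace A B C := by
  have := isFiniteMeasure_haarState hd
  have hi : ∀ X : Matrix (Fin d) (Fin d) ℂ,
      Integrable (fun ψ : StateVector d => expectation X ψ.1 ^ 3) (haarState d) := fun X =>
    (((continuous_expectation X).comp continuous_subtype_val).pow 3).integrable_of_hasCompactSupport
      (HasCompactSupport.of_compactSpace _)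
  -- Polarization: `x y z` as a combination of cubes of partial sums.
  have hpol : ∀ ψ : StateVector d,
      expectation A ψ.1 * expectation B ψ.1 * expectation C ψ.1 =
      6⁻¹ * (expectation (A + B + C) ψ.1 ^ 3 - expectation (A + B) ψ.1 ^ 3 -
        expectation (A + C) ψ.1 ^ 3 - expectation (B + C) ψ.1 ^ 3 + expectation A ψ.1 ^ 3 +
        expectation B ψ.1 ^ 3 + expectation C ψ.1 ^ 3) := fun ψ => by
    simp only [expectation_add]; ring
  simp only [hpol]
  rw [integral_const_mul, integral_add, integral_add, integral_add, integral_sub, integral_sub,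
    integral_sub] <;> try fun_prop (disch := exact hi _)
  have e1 := integral_expectation_cube hd ((hA.add hB).add hC)
  have e2 := integral_expectation_cube hd (hA.add hB)
  have e3 := integral_expectation_cube hd (hA.add hC)
  have e4 := integral_expectation_cube hd (hB.add hC)
  have e5 := integral_expectation_cube hd hA
  have e6 := integral_expectation_cube hd hB
  have e7 := integral_expectation_cube hd hC
  push_cast
  rw [mul_assoc, add_mul, add_mul, add_mul, sub_mul, sub_mul, sub_mul, e1, e2, e3, e4, e5, e6, e7]
  have c2 : ∀ X Y : Matrix (Fin d) (Fin d) ℂ, (Y * X).trace = (X * Y).trace :=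
    fun X Y => Matrix.trace_mul_comm _ _
  have c3 : ∀ X Y Z : Matrix (Fin d) (Fin d) ℂ, (Y * Z * X).trace = (X * Y * Z).trace :=
    fun X Y Z => by rw [Matrix.trace_mul_comm, mul_assoc]
  have c4 : ∀ X Y Z : Matrix (Fin d) (Fin d) ℂ, (Z * X * Y).trace = (X * Y * Z).trace :=
    fun X Y Z => by rw [mul_assoc, Matrix.trace_mul_comm]
  simp only [symmetricTrace, pow_succ, pow_zero, one_mul, add_mul, mul_add, Matrix.trace_add,
    c2 A B, c2 A C, c2 B C, c3 A A B, c4 A A B, c3 A A C, c4 A A C, c3 B B A, c4 B B A, c3 B B C,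
    c4 B B C, c3 C C A, c4 C C A, c3 C C B, c4 C C B, c3 A B C, c4 A B C, c3 B A C, c4 B A C]
  ring

/-! ### Positive semidefinite matrices -/

namespace Matrix

variable {n : Type*} [Fintype n] [DecidableEq n] {A B : Matrix n n ℂ}

theorem PosSemidef.re_trace_mul_nonneg (hA : A.PosSemidef) (hB : B.PosSemidef) :
    0 ≤ (A * B).trace.re := by
  have hsp := hB.1.spectral_theorem
  rw [Unitary.conjStarAlgAut_apply] at hsp
  have hl := hB.eigenvalues_nonneg
  generalize hB.1.eigenvectorUnitary.1 = U at hsp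
  rw [hsp, ← mul_assoc, trace_mul_comm, ← mul_assoc, ← mul_assoc, trace, Complex.re_sum]
  refine Finset.sum_nonneg fun i _ => ?_
  have h1 : 0 ≤ (star U * A * U) i i := (hA.conjTranspose_mul_mul_same U).diag_nonneg
  have h2 : (0 : ℂ) ≤ (hB.1.eigenvalues i : ℂ) := by exact_mod_cast hl i
  rw [diag_apply, mul_diagonal]
  exact (Complex.le_def.1 (mul_nonneg h1 h2)).1

theorem IsHermitian.trace_im (hA : A.IsHermitian) : A.trace.im = 0 := by
  rw [hA.trace_eq_sum_eigenvalues]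
  simp

omit [DecidableEq n] in
theorem IsHermitian.trace_mul_im (hA : A.IsHermitian) (hB : B.IsHermitian) :
    (A * B).trace.im = 0 := by
  have h : star (A * B).trace = (A * B).trace := by
    rw [← trace_conjTranspose, conjTranspose_mul, hA.eq, hB.eq, trace_mul_comm]
  exact Complex.conj_eq_iff_im.1 h

theorem PosSemidef.trace_eq_coe_re (hA : A.PosSemidef) : A.trace = (A.trace.re : ℂ) :=
  Complex.ext (by simp) (by simp [hA.1.trace_im])

omit [DecidableEq n] in
theorem PosSemidef.re_trace_nonneg (hA : A.PosSemidef) : 0 ≤ A.trace.re :=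
  (Complex.le_def.1 hA.trace_nonneg).1

theorem IsHermitian.posSemidef_smul_one_sub (hA : A.IsHermitian) {c : ℝ}
    (h : ∀ i, hA.eigenvalues i ≤ c) : ((c : ℂ) • (1 : Matrix n n ℂ) - A).PosSemidef := by
  have hsp := hA.spectral_theorem
  rw [Unitary.conjStarAlgAut_apply] at hsp
  have hU : hA.eigenvectorUnitary.1 * star hA.eigenvectorUnitary.1 = 1 :=
    Unitary.coe_mul_star_self _
  generalize hA.eigenvectorUnitary.1 = U at hsp hU
  have : (c : ℂ) • (1 : Matrix n n ℂ) - A =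
      U * diagonal (fun i => ((c - hA.eigenvalues i : ℝ) : ℂ)) * Uᴴ := by
    have e : diagonal (fun i => ((c - hA.eigenvalues i : ℝ) : ℂ)) =
        (c : ℂ) • (1 : Matrix n n ℂ) - diagonal (RCLike.ofReal ∘ hA.eigenvalues) := by
      ext i j
      by_cases hij : i = j <;> simp [hij]
    conv_lhs => rw [hsp]
    rw [e, mul_sub, sub_mul, mul_smul_comm, mul_one, smul_mul_assoc, ← star_eq_conjTranspose, hU]
  rw [this]
  refine PosSemidef.mul_mul_conjTranspose_same (.diagonal fun i => ?_) U
  have := sub_nonneg.2 (h i)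
  simp only [Pi.zero_apply]
  exact_mod_cast this

theorem PosSemidef.posSemidef_trace_smul_one_sub (hA : A.PosSemidef) :
    (A.trace • (1 : Matrix n n ℂ) - A).PosSemidef := by
  have h : A.trace = ((∑ i, hA.1.eigenvalues i : ℝ) : ℂ) := by
    rw [hA.1.trace_eq_sum_eigenvalues]; simp
  rw [h]
  exact hA.1.posSemidef_smul_one_sub fun i =>
    Finset.single_le_sum (fun j _ => hA.eigenvalues_nonneg j) (Finset.mem_univ i)

theorem trace_eq_one_of_isStarProjection_of_rank_eq_one (hA : IsStarProjection A)
    (hr : A.rank = 1) : A.trace = 1 := by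
  have hi : IsIdempotentElem (toLin' A) := by
    rw [IsIdempotentElem, Module.End.mul_eq_comp, ← toLin'_mul, hA.isIdempotentElem.eq]
  have := (LinearMap.IsIdempotentElem.isProj_range _ hi).trace
  rw [trace_toLin'_eq] at this
  rw [this]
  have : Module.finrank ℂ (LinearMap.range (toLin' A)) = 1 := hr
  rw [this, Nat.cast_one]

end Matrix

/-! ### Density matrices and optimal estimators for one positive operator -/

namespace DensityMatrix

variable {d : ℕ}

/-- A nonzero positive semidefinite matrix, normalized to a density matrix. -/
noncomputable def normalize {A : Matrix (Fin d) (Fin d) ℂ} (hA : A.PosSemidef) (h : A ≠ 0) :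
    DensityMatrix d :=
  ⟨A.trace⁻¹ • A, hA.smul (inv_nonneg.2 hA.trace_nonneg), by
    rw [Matrix.trace_smul, smul_eq_mul, inv_mul_cancel₀ (mt hA.trace_eq_zero_iff.1 h)]⟩

theorem posSemidef_one_sub (σ : DensityMatrix d) : (1 - σ.1).PosSemidef := by
  have := σ.2.1.posSemidef_trace_smul_one_sub
  rwa [σ.2.2, one_smul] at this

theorem re_trace_mul_le (σ : DensityMatrix d) {A : Matrix (Fin d) (Fin d) ℂ}
    (hA : A.PosSemidef) : (A * σ.1).trace.re ≤ A.trace.re := by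
  have := hA.re_trace_mul_nonneg σ.posSemidef_one_sub
  rw [mul_sub, mul_one, Matrix.trace_sub, Complex.sub_re] at this
  linarith

theorem re_trace_mul_nonneg (σ : DensityMatrix d) {A : Matrix (Fin d) (Fin d) ℂ}
    (hA : A.PosSemidef) : 0 ≤ (A * σ.1).trace.re :=
  hA.re_trace_mul_nonneg σ.2.1

end DensityMatrix

theorem Matrix.IsHermitian.exists_densityMatrix_eigenvalue {d : ℕ}
    {A : Matrix (Fin d) (Fin d) ℂ} (hA : A.IsHermitian) (i : Fin d) :
    ∃ σ : DensityMatrix d, (A * σ.1).trace.re = hA.eigenvalues i := by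
  set b := hA.eigenvectorBasis with hb
  let v : Fin d → ℂ := fun k => b i k
  have hAv : A.mulVec v = (hA.eigenvalues i : ℂ) • v := by
    ext k
    simpa using congrFun (hA.mulVec_eigenvectorBasis i) k
  have hv : (vecMulVec v (star v)).trace = 1 := by
    have h := b.orthonormal.1 i
    have h2 := EuclideanSpace.norm_sq_eq (b i)
    rw [h] at h2
    rw [trace_vecMulVec, dotProduct]
    simp only [Pi.star_apply, Complex.star_def, Complex.mul_conj, Complex.normSq_eq_norm_sq]
    rw [← Complex.ofReal_sum, ← h2]
    norm_num
  refine ⟨⟨vecMulVec v (star v), posSemidef_vecMulVec_self_star v, hv⟩, ?_⟩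
  rw [mul_vecMulVec, hAv, smul_vecMulVec, trace_smul, hv, smul_eq_mul, mul_one,
    Complex.ofReal_re]

/-- `σ` projects onto a top eigenvector. If the top eigenvalue equals the trace, the other
eigenvalues, being nonnegative, all vanish. -/
theorem Matrix.PosSemidef.exists_densityMatrix_max {d : ℕ} (hd : 1 ≤ d)
    {A : Matrix (Fin d) (Fin d) ℂ} (hA : A.PosSemidef) :
    ∃ σ : DensityMatrix d, (∀ τ : DensityMatrix d, (A * τ.1).trace.re ≤ (A * σ.1).trace.re) ∧
      ((A * σ.1).trace.re = A.trace.re → ∃ w : Fin d → ℂ, A = vecMulVec w (star w)) := by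
  have : NeZero d := ⟨by omega⟩
  obtain ⟨i₀, hi₀⟩ := Finite.exists_max hA.1.eigenvalues
  set lam := hA.1.eigenvalues with hlam
  obtain ⟨σ, hval⟩ := hA.1.exists_densityMatrix_eigenvalue i₀
  refine ⟨σ, fun τ => ?_, fun h => ?_⟩
  · have := (hA.1.posSemidef_smul_one_sub hi₀).re_trace_mul_nonneg τ.2.1
    rw [sub_mul, smul_mul_assoc, one_mul, trace_sub, trace_smul, τ.2.2, smul_eq_mul, mul_one,
      Complex.sub_re, Complex.ofReal_re] at this
    rw [hval, ← hlam]
    linarith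
  · have hnn := hA.eigenvalues_nonneg
    have hs : ∑ i ∈ Finset.univ.erase i₀, lam i = 0 := by
      have h1 : A.trace.re = ∑ i, lam i := by
        rw [hA.1.trace_eq_sum_eigenvalues]; simp [hlam]
      rw [hval, h1, ← Finset.add_sum_erase _ _ (Finset.mem_univ i₀)] at h
      linarith
    have hz : ∀ i, i ≠ i₀ → lam i = 0 := fun i hi =>
      (Finset.sum_eq_zero_iff_of_nonneg fun j _ => hnn j).1 hs i
        (Finset.mem_erase.2 ⟨hi, Finset.mem_univ i⟩)
    refine ⟨fun k => (Real.sqrt (lam i₀) : ℂ) * hA.1.eigenvectorBasis i₀ k, ?_⟩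
    have hsq : (Real.sqrt (lam i₀) : ℂ) * (Real.sqrt (lam i₀) : ℂ) = lam i₀ := by
      rw [← Complex.ofReal_mul, Real.mul_self_sqrt (hnn i₀)]
    have hsp := hA.1.spectral_theorem
    rw [Unitary.conjStarAlgAut_apply] at hsp
    conv_lhs => rw [hsp]
    ext a c
    rw [mul_apply, Finset.sum_eq_single i₀]
    · rw [mul_diagonal, vecMulVec_apply, star_apply, IsHermitian.eigenvectorUnitary_apply,
        IsHermitian.eigenvectorUnitary_apply]
      simp only [Function.comp_apply, Pi.star_apply, star_mul', Complex.star_def,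
        Complex.conj_ofReal]
      change _ * (lam i₀ : ℂ) * _ = _
      rw [← hsq]; ring
    · intro i _ hi
      rw [mul_diagonal, Function.comp_apply, ← hlam, hz i hi]
      simp
    · simp

/-! ### Suprema of sums of independently chosen terms -/

section Optimization

variable {ι S : Type*} {f : ι → S → ℝ} {g : ι → ℝ}

theorem summable_of_bounds (h0 : ∀ i s, 0 ≤ f i s) (hfg : ∀ i s, f i s ≤ g i)
    (hg : Summable g) (e : ι → S) : Summable fun i => f i (e i) :=
  Summable.of_nonneg_of_le (fun i => h0 i _) (fun i => hfg i _) hg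

theorem iSup_tsum_eq_of_forall_le (h0 : ∀ i s, 0 ≤ f i s) (hfg : ∀ i s, f i s ≤ g i)
    (hg : Summable g) (e : ι → S) (he : ∀ i s, f i s ≤ f i (e i)) :
    ⨆ e' : ι → S, ∑' i, f i (e' i) = ∑' i, f i (e i) := by
  have : Nonempty (ι → S) := ⟨e⟩
  have hs := summable_of_bounds h0 hfg hg
  have hle : ∀ e' : ι → S, ∑' i, f i (e' i) ≤ ∑' i, f i (e i) := fun e' =>
    (hs e').tsum_le_tsum (fun i => he i _) (hs e)
  exact le_antisymm (ciSup_le hle) (le_ciSup (f := fun e' : ι → S => ∑' i, f i (e' i))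
    ⟨_, Set.forall_mem_range.2 hle⟩ e)

/-- The choices at different indices are independent: a better value at `i` alone would strictly
raise the sum above the supremum. -/
theorem le_of_iSup_tsum_eq (h0 : ∀ i s, 0 ≤ f i s) (hfg : ∀ i s, f i s ≤ g i)
    (hg : Summable g) (e : ι → S)
    (he : ⨆ e' : ι → S, ∑' i, f i (e' i) = ∑' i, f i (e i)) (i : ι) (s : S) :
    f i s ≤ f i (e i) := by
  classical
  have hs := summable_of_bounds h0 hfg hg
  by_contra! hlt
  have hbdd : BddAbove (Set.range fun e' : ι → S => ∑' i, f i (e' i)) :=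
    ⟨_, Set.forall_mem_range.2 fun e' => (hs e').tsum_le_tsum (fun i => hfg i _) hg⟩
  have h1 := le_ciSup hbdd (Function.update e i s)
  rw [he] at h1
  refine h1.not_gt ((hs e).tsum_lt_tsum (i := i) (fun j => ?_) (by simpa using hlt)
    (hs (Function.update e i s)))
  by_cases hj : j = i
  · subst hj; simpa using hlt.le
  · simp [hj]

end Optimization

/-! ### Fidelities as explicit sums -/

theorem integral_expectation_mul_mul_eq {d : ℕ} (hd : 1 ≤ d) {A B C : Matrix (Fin d) (Fin d) ℂ}
    (hA : A.IsHermitian) (hB : B.IsHermitian) (hC : C.IsHermitian) :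
    ∫ ψ, expectation A ψ.1 * expectation B ψ.1 * expectation C ψ.1 ∂haarState d =
      (symmetricTrace A B C).re / (d * (d + 1) * (d + 2)) := by
  have hd' : (0 : ℝ) < d := by exact_mod_cast hd
  rw [eq_div_iff (by positivity), ← integral_expectation_mul_mul hd hA hB hC]
  norm_cast

theorem integral_expectation_mul_eq {d : ℕ} (hd : 1 ≤ d) {A C : Matrix (Fin d) (Fin d) ℂ}
    (hA : A.IsHermitian) (hC : C.IsHermitian) (hC1 : C.trace = 1) :
    ∫ ψ, expectation A ψ.1 * expectation C ψ.1 ∂haarState d =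
      (A.trace.re + (A * C).trace.re) / (d * (d + 1)) := by
  have hd' : (0 : ℝ) < d := by exact_mod_cast hd
  -- The second moment is the third one with `1` in a slot, as `⟨1⟩ = 1` on the sphere; the factor
  -- `d + 2` cancels.
  have h := integral_expectation_mul_mul_eq hd hA Matrix.isHermitian_one hC
  simp only [expectation_one, mul_one] at h
  have e : symmetricTrace A 1 C = (d + 2 : ℝ) * (A.trace + (A * C).trace) := by
    simp only [symmetricTrace, Matrix.trace_one, mul_one, one_mul, hC1, Fintype.card_fin]
    push_cast
    ring
  rw [h, e, Complex.re_ofReal_mul, Complex.add_re]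
  field_simp

theorem expectation_nonneg {d : ℕ} {A : Matrix (Fin d) (Fin d) ℂ} (hA : A.PosSemidef)
    (x : EuclideanSpace ℂ (Fin d)) : 0 ≤ expectation A x :=
  (Matrix.posSemidef_vecMulVec_self_star _).re_trace_mul_nonneg hA

theorem symmetricTrace_re_nonneg {d : ℕ} (hd : 1 ≤ d) {A B C : Matrix (Fin d) (Fin d) ℂ}
    (hA : A.PosSemidef) (hB : B.PosSemidef) (hC : C.PosSemidef) :
    0 ≤ (symmetricTrace A B C).re := by
  have hd' : (0 : ℝ) < d := by exact_mod_cast hd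
  have h := integral_expectation_mul_mul_eq hd hA.1 hB.1 hC.1
  rw [eq_div_iff (by positivity)] at h
  rw [← h]
  refine mul_nonneg (integral_nonneg fun ψ => mul_nonneg (mul_nonneg ?_ ?_) ?_) (by positivity)
  exacts [expectation_nonneg hA _, expectation_nonneg hB _, expectation_nonneg hC _]

theorem symmetricTrace_sub {d : ℕ} (A B C D : Matrix (Fin d) (Fin d) ℂ) :
    symmetricTrace A B (C - D) = symmetricTrace A B C - symmetricTrace A B D := by
  simp only [symmetricTrace, mul_sub, Matrix.trace_sub]
  ring

theorem symmetricTrace_re_le {d : ℕ} (hd : 1 ≤ d) {A B : Matrix (Fin d) (Fin d) ℂ}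
    (hA : A.PosSemidef) (hB : B.PosSemidef) (σ : DensityMatrix d) :
    (symmetricTrace A B σ.1).re ≤ (symmetricTrace A B 1).re := by
  have := symmetricTrace_re_nonneg hd hA hB σ.posSemidef_one_sub
  rw [symmetricTrace_sub, Complex.sub_re] at this
  linarith

namespace POVM

variable {ι : Type*} {d : ℕ} (A : POVM ι (Fin d))

theorem hasSum_apply (a b : Fin d) :
    HasSum (fun j => A.elem j a b) ((1 : Matrix (Fin d) (Fin d) ℂ) a b) :=
  Pi.hasSum.1 (Pi.hasSum.1 A.hasSum_one a) b

theorem hasSum_re_trace : HasSum (fun j => (A.elem j).trace.re) d := by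
  have h := Complex.hasSum_re (hasSum_sum (s := Finset.univ) fun a _ => A.hasSum_apply a a)
  simpa [Matrix.trace] using h

theorem hasSum_mul_real {ι' : Type*} {f : ι → ℝ} {g : ι' → ℝ} {a b : ℝ} (hf : HasSum f a)
    (hg : HasSum g b) : HasSum (fun p : ι × ι' => f p.1 * g p.2) (a * b) :=
  hf.mul hg (summable_mul_of_summable_norm (f := f) (g := g) hf.summable.norm hg.summable.norm)

theorem hasSum_re_trace_mul_re_trace :
    HasSum (fun p : ι × ι => (A.elem p.1).trace.re * (A.elem p.2).trace.re) (d * d) :=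
  hasSum_mul_real (f := fun j => (A.elem j).trace.re) (g := fun j => (A.elem j).trace.re)
    A.hasSum_re_trace A.hasSum_re_trace

theorem hasSum_re_trace_mul :
    HasSum (fun p : ι × ι => (A.elem p.1 * A.elem p.2).trace.re) d := by
  have h := Complex.hasSum_re (hasSum_sum (s := Finset.univ) fun a _ =>
    hasSum_sum (s := Finset.univ) fun b _ =>
      hasSum_mul_complex (A.hasSum_apply a b) (A.hasSum_apply b a))
  have e : (∑ a : Fin d, ∑ b : Fin d, (1 : Matrix (Fin d) (Fin d) ℂ) a b *
      (1 : Matrix (Fin d) (Fin d) ℂ) b a).re = d := by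
    simp [Matrix.one_apply]
  rw [e] at h
  simpa only [Matrix.trace, Matrix.diag, Matrix.mul_apply] using h

/-- The sum that the two-copy estimation fidelity is compared with. -/
theorem hasSum_pairs : HasSum (fun p : ι × ι =>
    (2 * ((A.elem p.1).trace.re * (A.elem p.2).trace.re) +
      4 * (A.elem p.1 * A.elem p.2).trace.re) / (d * (d + 1) * (d + 2) : ℝ))
    ((2 * (d * d) + 4 * d) / (d * (d + 1) * (d + 2))) :=
  ((A.hasSum_re_trace_mul_re_trace.mul_left 2).add (A.hasSum_re_trace_mul.mul_left 4)).div_const _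

/-- The contribution of an outcome to the one-copy fidelity. -/
noncomputable def oneCopyTerm (j : ι) (σ : DensityMatrix d) : ℝ :=
  ((A.elem j).trace.re + (A.elem j * σ.1).trace.re) / (d * (d + 1))

/-- The contribution of a pair of outcomes to the two-copy fidelity. -/
noncomputable def twoCopyTerm (p : ι × ι) (σ : DensityMatrix d) : ℝ :=
  (symmetricTrace (A.elem p.1) (A.elem p.2) σ.1).re / (d * (d + 1) * (d + 2))

theorem fidelityOneCopy_eq (hd : 1 ≤ d) :
    A.fidelityOneCopy = ⨆ est : ι → DensityMatrix d, ∑' j, A.oneCopyTerm j (est j) :=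
  iSup_congr fun est => tsum_congr fun j =>
    integral_expectation_mul_eq hd (A.posSemidef j).1 (est j).2.1.1 (est j).2.2

theorem fidelityTwoCopy_eq (hd : 1 ≤ d) :
    (A.tensor A).fidelityTwoCopy =
      ⨆ est : ι × ι → DensityMatrix d, ∑' p, A.twoCopyTerm p (est p) := by
  refine iSup_congr fun est => tsum_congr fun p => ?_
  rw [twoCopyTerm, ← integral_expectation_mul_mul_eq hd (A.posSemidef p.1).1 (A.posSemidef p.2).1
    (est p).2.1.1]
  refine integral_congr_ae (Filter.Eventually.of_forall fun ψ => ?_)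
  -- With a real first factor, the real part of the product of traces splits.
  have him : (pureState ψ * A.elem p.1).trace.im = 0 :=
    (Matrix.posSemidef_vecMulVec_self_star _).1.trace_mul_im (A.posSemidef p.1).1
  simp only [tensor, ← Matrix.mul_kronecker_mul, Matrix.trace_kronecker, Complex.mul_re, him,
    zero_mul, sub_zero]
  rfl

theorem oneCopyTerm_nonneg (j : ι) (σ : DensityMatrix d) : 0 ≤ A.oneCopyTerm j σ :=
  div_nonneg (add_nonneg (A.posSemidef j).re_trace_nonneg (σ.re_trace_mul_nonneg (A.posSemidef j)))
    (by positivity)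

theorem oneCopyTerm_le (j : ι) (σ : DensityMatrix d) :
    A.oneCopyTerm j σ ≤ 2 * (A.elem j).trace.re / (d * (d + 1)) := by
  have := σ.re_trace_mul_le (A.posSemidef j)
  exact div_le_div_of_nonneg_right (by linarith) (by positivity)

theorem hasSum_oneCopy_bound (hd : 1 ≤ d) :
    HasSum (fun j => 2 * (A.elem j).trace.re / (d * (d + 1) : ℝ)) (2 / (d + 1)) := by
  have hd' : (0 : ℝ) < d := by exact_mod_cast hd
  have e : 2 / ((d : ℝ) + 1) = 2 * d / (d * (d + 1)) := by field_simp
  rw [e]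
  exact (A.hasSum_re_trace.mul_left 2).div_const _

theorem twoCopyTerm_nonneg (hd : 1 ≤ d) (p : ι × ι) (σ : DensityMatrix d) :
    0 ≤ A.twoCopyTerm p σ :=
  div_nonneg (symmetricTrace_re_nonneg hd (A.posSemidef _) (A.posSemidef _) σ.2.1) (by positivity)

theorem twoCopyTerm_le (hd : 1 ≤ d) (p : ι × ι) (σ : DensityMatrix d) :
    A.twoCopyTerm p σ ≤
      (symmetricTrace (A.elem p.1) (A.elem p.2) 1).re / (d * (d + 1) * (d + 2)) :=
  div_le_div_of_nonneg_right (symmetricTrace_re_le hd (A.posSemidef _) (A.posSemidef _) σ)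
    (by positivity)

theorem re_trace_mul_trace (j k : ι) : ((A.elem j).trace * (A.elem k).trace).re =
    (A.elem j).trace.re * (A.elem k).trace.re := by
  rw [Complex.mul_re, (A.posSemidef j).1.trace_im, zero_mul, sub_zero]

theorem summable_twoCopy_bound : Summable fun p : ι × ι =>
    (symmetricTrace (A.elem p.1) (A.elem p.2) 1).re / (d * (d + 1) * (d + 2) : ℝ) := by
  have e : ∀ p : ι × ι, (symmetricTrace (A.elem p.1) (A.elem p.2) 1).re =
      (d + 2) * ((A.elem p.1).trace.re * (A.elem p.2).trace.re) +
        (d + 2) * (A.elem p.1 * A.elem p.2).trace.re := fun p => by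
    have : symmetricTrace (A.elem p.1) (A.elem p.2) 1 = ((d + 2 : ℝ) : ℂ) *
        ((A.elem p.1).trace * (A.elem p.2).trace + (A.elem p.1 * A.elem p.2).trace) := by
      simp only [symmetricTrace, mul_one, Matrix.trace_one, Fintype.card_fin,
        Matrix.trace_mul_comm (A.elem p.2) (A.elem p.1)]
      push_cast
      ring
    rw [this, Complex.re_ofReal_mul, Complex.add_re, re_trace_mul_trace]
    ring
  simp only [e]
  exact ((A.hasSum_re_trace_mul_re_trace.summable.mul_left _).add
    (A.hasSum_re_trace_mul.summable.mul_left _)).div_const _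

/-- If the symmetric traces of some estimators agree with `hasSum_pairs`, the attained two-copy
fidelity is `2 / (d + 1)`. -/
theorem tsum_twoCopyTerm_eq (hd : 1 ≤ d) (est : ι × ι → DensityMatrix d)
    (h : ∀ p, (symmetricTrace (A.elem p.1) (A.elem p.2) (est p).1).re =
      2 * ((A.elem p.1).trace.re * (A.elem p.2).trace.re) +
        4 * (A.elem p.1 * A.elem p.2).trace.re) :
    ∑' p, A.twoCopyTerm p (est p) = 2 / (d + 1) := by
  have hd' : (0 : ℝ) < d := by exact_mod_cast hd
  simp only [twoCopyTerm, h]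
  rw [A.hasSum_pairs.tsum_eq]
  field_simp
  ring

/-- Independence says nothing when there is a single outcome; its element is then `1`. -/
theorem IsSimple.elem_ne_zero {A : POVM ι (Fin d)} (hd : 1 ≤ d) (hA : A.IsSimple) (j : ι) :
    A.elem j ≠ 0 := by
  have : NeZero d := ⟨by omega⟩
  by_cases h : ∃ k, k ≠ j
  · obtain ⟨k, hk⟩ := h
    exact (hA hk.symm).ne_zero 0
  · push Not at h
    have h1 := (hasSum_single j fun k hk => absurd (h k) hk).unique A.hasSum_one
    rw [h1]
    exact one_ne_zero

/-! ### Rank-one projective measurements -/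

theorem IsRankOneProjective.fidelities {A : POVM ι (Fin d)} (hd : 1 ≤ d)
    (hA : A.IsRankOneProjective) :
    A.fidelityOneCopy = 2 / ((d : ℝ) + 1) ∧
      (A.tensor A).fidelityTwoCopy = 2 / ((d : ℝ) + 1) := by
  have ht : ∀ j, (A.elem j).trace = 1 := fun j =>
    Matrix.trace_eq_one_of_isStarProjection_of_rank_eq_one (hA.1 j).1 (hA.1 j).2
  have hi : ∀ j, A.elem j * A.elem j = A.elem j := fun j => (hA.1 j).1.isIdempotentElem.eq
  let e : ι → DensityMatrix d := fun j => ⟨A.elem j, A.posSemidef j, ht j⟩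
  constructor
  · rw [A.fidelityOneCopy_eq hd, iSup_tsum_eq_of_forall_le A.oneCopyTerm_nonneg A.oneCopyTerm_le
      (A.hasSum_oneCopy_bound hd).summable e]
    · rw [← (A.hasSum_oneCopy_bound hd).tsum_eq]
      refine tsum_congr fun j => ?_
      simp only [oneCopyTerm, e, hi, two_mul]
    · intro j σ
      refine (A.oneCopyTerm_le j σ).trans_eq ?_
      simp only [oneCopyTerm, e, hi, two_mul]
  · have hval : ∀ p : ι × ι, (symmetricTrace (A.elem p.1) (A.elem p.2) (e p.1).1).re =
        2 * ((A.elem p.1).trace.re * (A.elem p.2).trace.re) +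
          4 * (A.elem p.1 * A.elem p.2).trace.re := by
      rintro ⟨j, k⟩
      by_cases hjk : j = k
      · subst hjk
        simp only [symmetricTrace, e, hi, ht]
        norm_num
      · simp only [symmetricTrace, e, hi, ht, hA.2 hjk, hA.2 (Ne.symm hjk)]
        norm_num
    rw [A.fidelityTwoCopy_eq hd, iSup_tsum_eq_of_forall_le (A.twoCopyTerm_nonneg hd)
      (A.twoCopyTerm_le hd) A.summable_twoCopy_bound fun p => e p.1]
    · exact A.tsum_twoCopyTerm_eq hd _ hval
    · rintro ⟨j, k⟩ σ
      refine div_le_div_of_nonneg_right ?_ (by positivity)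
      rw [hval]
      have hj := σ.re_trace_mul_le (A.posSemidef j)
      -- On the diagonal the symmetric trace is `2 + 4 tr (A_j σ)`; off it, `1 + tr (A_j σ) + tr
      -- (A_k σ)`.
      by_cases hjk : j = k
      · subst hjk
        simp only [symmetricTrace, hi, ht, σ.2.2, Complex.add_re, mul_one, Complex.one_re] at hj ⊢
        linarith
      · have hP : (1 - (A.elem j + A.elem k)).PosSemidef := by
          -- The complement of a sum of two orthogonal projectors is itself a projector.
          have h1 : (1 - (A.elem j + A.elem k)) =
              (1 - (A.elem j + A.elem k)).conjTranspose * (1 - (A.elem j + A.elem k)) := by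
            rw [((Matrix.isHermitian_one.sub
              ((A.posSemidef j).1.add (A.posSemidef k).1))).eq]
            simp only [mul_sub, sub_mul, mul_add, add_mul, mul_one, one_mul, hi, hA.2 hjk,
              hA.2 (Ne.symm hjk)]
            abel
          rw [h1]
          exact Matrix.posSemidef_conjTranspose_mul_self _
        have hPσ := hP.re_trace_mul_nonneg σ.2.1
        simp only [sub_mul, add_mul, one_mul, Matrix.trace_sub, Matrix.trace_add, σ.2.2,
          Complex.sub_re, Complex.add_re, Complex.one_re] at hPσ
        simp only [symmetricTrace, ht, σ.2.2, hA.2 hjk, hA.2 (Ne.symm hjk), Complex.add_re,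
          mul_one, zero_mul, Matrix.trace_zero, Complex.one_re, Complex.zero_re]
        linarith

end POVM

/-! ### Rank-one elements with a self-normalized optimal estimator are orthogonal -/

theorem Matrix.vecMulVec_star_mul_mul_self {n : Type*} [Fintype n] (w : n → ℂ)
    (X : Matrix n n ℂ) : vecMulVec w (star w) * X * vecMulVec w (star w) =
      (vecMulVec w (star w) * X).trace • vecMulVec w (star w) := by
  rw [vecMulVec_mul, vecMulVec_mul_vecMulVec, trace_vecMulVec, dotProduct_comm, vecMulVec_smul]

theorem symmetricTrace_normalize {d : ℕ} {A B : Matrix (Fin d) (Fin d) ℂ} (hA : A.PosSemidef)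
    (hA0 : A ≠ 0) (hAr : ∀ X, A * X * A = (A * X).trace • A) :
    symmetricTrace A B (DensityMatrix.normalize hA hA0).1 =
      2 * (A.trace * B.trace) + 4 * (A * B).trace := by
  have ht : A.trace ≠ 0 := mt hA.trace_eq_zero_iff.1 hA0
  have hAA : A * A = A.trace • A := by simpa using hAr 1
  have hBAA : (B * A * A).trace = A.trace * (A * B).trace := by
    rw [mul_assoc, hAA, mul_smul_comm, Matrix.trace_smul, smul_eq_mul, Matrix.trace_mul_comm]
  simp only [symmetricTrace, DensityMatrix.normalize, mul_smul_comm, Matrix.trace_smul,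
    smul_eq_mul, hAA, hAr, hBAA, Matrix.trace_mul_comm B A]
  field_simp
  ring

/-- Optimality makes `w` a top eigenvector of the matrix `Q` below, hence an eigenvector of `B`. As
`B` is a multiple of the projector onto `u`, either `w ⟂ u` or `w ∥ u`, and independence excludes
the latter. -/
theorem mul_eq_zero_of_symmetricTrace_le {d : ℕ} {w u : Fin d → ℂ}
    {A B : Matrix (Fin d) (Fin d) ℂ} (hAw : A = Matrix.vecMulVec w (star w))
    (hBu : B = Matrix.vecMulVec u (star u)) (hA : A.PosSemidef) (hB : B.PosSemidef)
    (hA0 : A ≠ 0) (hAB : LinearIndependent ℂ ![A, B])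
    (hmax : ∀ σ : DensityMatrix d, (symmetricTrace A B σ.1).re ≤
      (symmetricTrace A B (DensityMatrix.normalize hA hA0).1).re) : A * B = 0 := by
  have ht : A.trace ≠ 0 := mt hA.trace_eq_zero_iff.1 hA0
  have hAr : ∀ X, A * X * A = (A * X).trace • A := fun X => by
    rw [hAw]; exact Matrix.vecMulVec_star_mul_mul_self w X
  have hBr : ∀ X, B * X * B = (B * X).trace • B := fun X => by
    rw [hBu]; exact Matrix.vecMulVec_star_mul_mul_self u X
  have hAA : A * A = A.trace • A := by simpa using hAr 1
  -- `Q` represents the part of the symmetric trace that depends on the estimator.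
  have hQ : ∃ Q : Matrix (Fin d) (Fin d) ℂ,
      Q = B.trace • A + A.trace • B + A * B + B * A := ⟨_, rfl⟩
  obtain ⟨Q, hQ⟩ := hQ
  have hQh : Q.IsHermitian := by
    rw [Matrix.IsHermitian, hQ, hA.trace_eq_coe_re, hB.trace_eq_coe_re]
    simp only [Matrix.conjTranspose_add, Matrix.conjTranspose_smul, Matrix.conjTranspose_mul,
      hA.1.eq, hB.1.eq, Complex.star_def, Complex.conj_ofReal]
    abel
  have hS : ∀ σ : DensityMatrix d, symmetricTrace A B σ.1 =
      A.trace * B.trace + (A * B).trace + (Q * σ.1).trace := fun σ => by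
    simp only [symmetricTrace, hQ, σ.2.2, add_mul, Matrix.trace_add, smul_mul_assoc,
      Matrix.trace_smul, smul_eq_mul]
    ring
  let P := DensityMatrix.normalize hA hA0
  have hle : ∀ σ : DensityMatrix d, (Q * σ.1).trace.re ≤ (Q * P.1).trace.re := fun σ => by
    have := hmax σ
    rw [hS, hS, Complex.add_re, Complex.add_re] at this
    exact le_of_add_le_add_left this
  let l : ℝ := (Q * P.1).trace.re
  have hM : ((l : ℂ) • (1 : Matrix (Fin d) (Fin d) ℂ) - Q).PosSemidef :=
    hQh.posSemidef_smul_one_sub fun i => by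
      obtain ⟨σ, hσ⟩ := hQh.exists_densityMatrix_eigenvalue i
      rw [← hσ]
      exact hle σ
  have hQP : (Q * P.1).trace = l :=
    Complex.ext rfl (by rw [hQh.trace_mul_im P.2.1.1, Complex.ofReal_im])
  have hQA : (Q * A).trace = A.trace * l := by
    rw [← hQP]
    simp only [P, DensityMatrix.normalize, mul_smul_comm, Matrix.trace_smul, smul_eq_mul]
    field_simp
  -- A positive semidefinite form that vanishes at `w` has `w` in its kernel.
  have hMA : ((l : ℂ) • (1 : Matrix (Fin d) (Fin d) ℂ) - Q) * A = 0 := by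
    have h0 : star w ⬝ᵥ ((l : ℂ) • (1 : Matrix (Fin d) (Fin d) ℂ) - Q).mulVec w = 0 := by
      rw [dotProduct_comm, ← Matrix.trace_vecMulVec, ← Matrix.mul_vecMulVec, ← hAw, sub_mul,
        Matrix.trace_sub, hQA, smul_mul_assoc, one_mul, Matrix.trace_smul, smul_eq_mul]
      ring
    rw [hAw, Matrix.mul_vecMulVec, (hM.dotProduct_mulVec_zero_iff w).1 h0, Matrix.zero_vecMulVec]
  rw [sub_mul, smul_mul_assoc, one_mul, sub_eq_zero, hQ, add_mul, add_mul, add_mul,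
    smul_mul_assoc, smul_mul_assoc, hAr, mul_assoc B A A, hAA, mul_smul_comm] at hMA
  -- In `Q A = l A`, rank one turns `A B A` and `A A` into multiples of `A`; `B A` occurs with total
  -- coefficient `2 tr A`.
  obtain ⟨c, hc⟩ : ∃ c : ℂ, B * A = c • A := by
    refine ⟨(2 * A.trace)⁻¹ * (l - B.trace * A.trace - (A * B).trace), ?_⟩
    have h2 : (2 * A.trace) • (B * A) =
        (l - B.trace * A.trace - (A * B).trace : ℂ) • A := by
      simp only [sub_smul, hMA, two_mul, add_smul, mul_smul]
      abel
    rw [mul_smul, ← h2, smul_smul, inv_mul_cancel₀ (mul_ne_zero two_ne_zero ht), one_smul]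
  have hc' : A * B = star c • A := by
    have := congrArg Matrix.conjTranspose hc
    rwa [Matrix.conjTranspose_mul, Matrix.conjTranspose_smul, hA.1.eq, hB.1.eq] at this
  -- Computing `B A B` in two ways gives `|c| ^ 2 A = tr (c A) B`.
  have hBAB := hBr A
  rw [hc, smul_mul_assoc, hc', smul_smul] at hBAB
  have hlin := (LinearIndependent.pair_iff.1 hAB (c * star c) (-(c • A).trace)
    (by rw [hBAB, neg_smul, add_neg_cancel])).1
  have hc0 : c = 0 := by simpa using hlin
  rw [hc', hc0, star_zero, zero_smul]

/-! ### From the fidelities back to a rank-one projective measurement -/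

namespace POVM

variable {ι : Type*} {d : ℕ} {A : POVM ι (Fin d)}

/-- The total attains its termwise bound, so each term does, which is the equality case of
`exists_densityMatrix_max`. -/
theorem exists_vecMulVec_of_fidelityOneCopy_eq (hd : 1 ≤ d)
    (h : A.fidelityOneCopy = 2 / ((d : ℝ) + 1)) (j : ι) :
    ∃ w : Fin d → ℂ, A.elem j = Matrix.vecMulVec w (star w) := by
  have hd' : (0 : ℝ) < d := by exact_mod_cast hd
  choose e he hev using fun j => (A.posSemidef j).exists_densityMatrix_max hd
  have hb := A.hasSum_oneCopy_bound hd
  rw [A.fidelityOneCopy_eq hd, iSup_tsum_eq_of_forall_le A.oneCopyTerm_nonneg A.oneCopyTerm_le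
    hb.summable e fun j σ => div_le_div_of_nonneg_right (by linarith [he j σ]) (by positivity),
    ← hb.tsum_eq] at h
  refine hev j (((e j).re_trace_mul_le (A.posSemidef j)).antisymm (le_of_not_gt fun hlt => ?_))
  refine (Summable.tsum_lt_tsum (i := j) (fun k => A.oneCopyTerm_le k (e k)) ?_
    (summable_of_bounds A.oneCopyTerm_nonneg A.oneCopyTerm_le hb.summable e) hb.summable).ne h
  exact div_lt_div_of_pos_right (by linarith) (by positivity)

theorem isRankOneProjective_of_fidelities (hd : 1 ≤ d) (hA : A.IsSimple)
    (h1 : A.fidelityOneCopy = 2 / ((d : ℝ) + 1))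
    (h2 : (A.tensor A).fidelityTwoCopy = 2 / ((d : ℝ) + 1)) : A.IsRankOneProjective := by
  choose w hw using exists_vecMulVec_of_fidelityOneCopy_eq hd h1
  have h0 := hA.elem_ne_zero hd
  let e : ι × ι → DensityMatrix d := fun p =>
    DensityMatrix.normalize (A.posSemidef p.1) (h0 p.1)
  have hsum : ∑' p, A.twoCopyTerm p (e p) = 2 / ((d : ℝ) + 1) :=
    A.tsum_twoCopyTerm_eq hd e fun p => by
      rw [symmetricTrace_normalize (A.posSemidef p.1) (h0 p.1) fun X => by
        rw [hw p.1]; exact Matrix.vecMulVec_star_mul_mul_self (w p.1) X, ← re_trace_mul_trace]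
      simp
  rw [A.fidelityTwoCopy_eq hd, ← hsum] at h2
  have hD : (0 : ℝ) < d * (d + 1) * (d + 2) := by
    have hd' : (0 : ℝ) < d := by exact_mod_cast hd
    positivity
  have hmax := le_of_iSup_tsum_eq (A.twoCopyTerm_nonneg hd) (A.twoCopyTerm_le hd)
    A.summable_twoCopy_bound e h2
  have horth : Pairwise fun j k => A.elem j * A.elem k = 0 := fun j k hjk =>
    mul_eq_zero_of_symmetricTrace_le (hw j) (hw k) (A.posSemidef j) (A.posSemidef k) (h0 j)
      (hA hjk) fun σ => (div_le_div_iff_of_pos_right hD).1 (hmax (j, k) σ)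
  refine ⟨fun j => ⟨⟨?_, (A.posSemidef j).1⟩, ?_⟩, horth⟩
  -- Multiplying `∑ A_k = 1` by `A_j` leaves only `A_j * A_j = A_j`.
  · have h := A.hasSum_one.mul_left (A.elem j)
    rw [mul_one] at h
    exact (hasSum_single j fun k hk => horth hk.symm).unique h
  · have hr : (A.elem j).rank ≠ 0 := fun h => h0 j (by
      rw [Matrix.rank, Submodule.finrank_eq_zero, LinearMap.range_eq_bot] at h
      exact Matrix.mulVec_injective (congrArg DFunLike.coe (h.trans Matrix.mulVecLin_zero.symm)))
    have hr' : (A.elem j).rank ≤ 1 := by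
      rw [hw j]
      exact Matrix.rank_vecMulVec_le _ _
    omega

end POVM

theorem corollary1 {d : ℕ} (hd : 1 ≤ d) {ι : Type*} (A : POVM ι (Fin d)) (hA : A.IsSimple) :
    A.IsRankOneProjective ↔
      (A.tensor A).fidelityTwoCopy = A.fidelityOneCopy ∧
        A.fidelityOneCopy = 2 / ((d : ℝ) + 1) :=
  ⟨fun h => ⟨(h.fidelities hd).2.trans (h.fidelities hd).1.symm, (h.fidelities hd).1⟩,
    fun h => POVM.isRankOneProjective_of_fidelities hd hA h.2 (h.1.trans h.2)⟩
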